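/- For a real matrix $M\in\mathbb{R}^{n\times d}$ with singular values $\sigma_1(M)\ge\dots\ge\sigma_d(M)\ge 0$ (the square roots of the eigenvalues of $M^\top M$, with multiplicity) and a real number $p>0$, write $\|M\|_{S_p}=\bigl(\sum_{i=1}^d\sigma_i(M)^p\bigr)^{1/p}$ for its Schatten-$p$ norm. Let $A\in\mathbb{R}^{n\times d}$, let $p>2$ be real, and let $u\in\mathbb{R}^d$ and $v\in\mathbb{R}^n$ be vectors of Euclidean norm $1$ such that $(I-vv^\top)\,A\,uu^\top=0$. Then $$\|A\|_{S_p}\;\le\;\left\|\begin{pmatrix}\|vv^\top A\,uu^\top\|_{S_p} & \|vv^\top A\,(I-uu^\top)\|_{S_p}\\[2pt] 0 & \|(I-vv^\top)\,A\,(I-uu^\top)\|_{S_p}\end{pmatrix}\right\|_{S_p}.$$ -/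

import Mathlib

/-- The Schatten-`p` norm of a real `n × d` matrix: the `ℓ_p` norm of its `d` singular values
(Mathlib lists them in decreasing order with multiplicity, starting from index `0`). -/
noncomputable def schattenNorm {n d : ℕ} (p : ℝ) (A : Matrix (Fin n) (Fin d) ℝ) : ℝ :=
  (∑ i ∈ Finset.range d, (Matrix.toEuclideanLin A).singularValues i ^ p) ^ (1 / p)

/-- The matrix `x xᵀ` of a vector `x`, i.e. the orthogonal projection onto the line spanned by `x`
when `x` is a unit vector. -/
def outerSelf {n : ℕ} (x : EuclideanSpace ℝ (Fin n)) : Matrix (Fin n) (Fin n) ℝ :=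
  Matrix.vecMulVec x.ofLp x.ofLp

/-! Put q = p/2, y = Aᵀv, C = (I − vvᵀ)A(I − uuᵀ), and let P project onto uᗮ. The hypothesis on A
gives ‖Az‖² = ⟨y,z⟩² + ‖CPz‖², where y = a u + β b with b a unit vector orthogonal to u. Let C have
singular values c_i and right singular vectors x_i, let γ = ‖C‖_{S_p}, and write c_i = γτ_i, so that
∑ τ_i^p ≤ 1. Then AᵀA = MᵀD²M, where M has rows y and γPx_i and D = diag(1, τ).

The Araki–Lieb–Thirring inequality (`sum_rpow_le_of_isSingularSystem`) gives ‖A‖_{S_p}^p ≤ tr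
D^{2q}(MMᵀ)^q. This is linear in the τ_i^p, hence at most the y-entry of the diagonal of (MMᵀ)^q
plus a common bound for the others. Now MᵀM = yyᵀ + γ²P acts on span(u, b) as KᵀK, where K has rows
(a, β) and (0, γ), and as γ² on the complement. The y-entry is therefore that of (KKᵀ)^q at (0,0),
and the others are at most its entry Z at (1,1), because γ^{2q} ≤ Z by Jensen. The sum is tr (KKᵀ)^q
= ‖K‖_{S_p}^p (`sum_rpow_le_of_plane`).

The trace inequality itself comes from Hadamard's three lines theorem
(`sum_rpow_le_of_factorization`). -/

/-! ### Entire powers of nonnegative reals -/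

/-- The complex power `x ^ z` of a nonnegative real number, with value `0` at `x = 0` for every
exponent, so that it is entire in `z` for every `x`. -/
noncomputable def entirePow (x : ℝ) (z : ℂ) : ℂ := if x = 0 then 0 else (x : ℂ) ^ z

lemma differentiable_entirePow (x : ℝ) : Differentiable ℂ (entirePow x) := by
  unfold entirePow
  by_cases hx : x = 0
  · simp [hx]
  · simp only [hx, if_false]
    intro z
    exact (differentiableAt_id).const_cpow (Or.inl (by exact_mod_cast hx))

lemma norm_entirePow_le_rpow {x : ℝ} (hx : 0 ≤ x) (z : ℂ) : ‖entirePow x z‖ ≤ x ^ z.re := by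
  unfold entirePow
  split_ifs with h
  · simpa using Real.rpow_nonneg hx _
  · rw [Complex.norm_cpow_eq_rpow_re_of_pos (lt_of_le_of_ne hx (Ne.symm h))]

lemma entirePow_ofReal {x : ℝ} (hx : 0 ≤ x) {r : ℝ} (hr : r ≠ 0) :
    entirePow x (r : ℂ) = ((x ^ r : ℝ) : ℂ) := by
  unfold entirePow
  split_ifs with h
  · simp [h, Real.zero_rpow hr]
  · rw [Complex.ofReal_cpow hx]

/-- The base `1 + x` gives one bound for a whole vertical strip, whether `x` is below or above 1. -/
lemma norm_entirePow_le_one_add_rpow {x : ℝ} (hx : 0 ≤ x) {z : ℂ} {b : ℝ} (h0 : 0 ≤ z.re)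
    (hb : z.re ≤ b) : ‖entirePow x z‖ ≤ (1 + x) ^ b :=
  (norm_entirePow_le_rpow hx z).trans <|
    (Real.rpow_le_rpow hx (by linarith) h0).trans
      (Real.rpow_le_rpow_of_exponent_le (by linarith) hb)

/-! ### Contractions and the three lines argument -/

/-- A real matrix, given by its entries, that does not increase Euclidean norms. -/
def IsContractionMatrix {ι κ : Type*} [Fintype ι] [Fintype κ] (E : ι → κ → ℝ) : Prop :=
  ∀ c : κ → ℝ, ∑ i, (∑ j, E i j * c j) ^ 2 ≤ ∑ j, c j ^ 2

namespace IsContractionMatrix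

variable {ι κ : Type*} [Fintype ι] [Fintype κ] {E : ι → κ → ℝ}

lemma sum_sq_col_le (hE : IsContractionMatrix E) (j : κ) : ∑ i, E i j ^ 2 ≤ 1 := by
  classical
  simpa [Pi.single_apply] using hE (Pi.single j 1)

lemma sum_norm_sq_le (hE : IsContractionMatrix E) (c : κ → ℂ) :
    ∑ i, ‖∑ j, (E i j : ℂ) * c j‖ ^ 2 ≤ ∑ j, ‖c j‖ ^ 2 := by
  have key : ∀ z : ℂ, ‖z‖ ^ 2 = z.re ^ 2 + z.im ^ 2 := fun z => by
    rw [Complex.sq_norm, Complex.normSq_apply]; ring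
  simp only [key, Finset.sum_add_distrib, Complex.re_sum, Complex.im_sum, Complex.re_ofReal_mul,
    Complex.im_ofReal_mul]
  exact add_le_add (hE _) (hE _)

end IsContractionMatrix

section

variable {ι κ η : Type*} [Fintype ι] [Fintype κ] [Fintype η]

lemma norm_sum_mul_sq_le {α : Type*} (s : Finset α) (f g : α → ℂ) :
    ‖∑ i ∈ s, f i * g i‖ ^ 2 ≤ (∑ i ∈ s, ‖f i‖ ^ 2) * ∑ i ∈ s, ‖g i‖ ^ 2 := by
  refine le_trans ?_ (Finset.sum_mul_sq_le_sq_mul_sq s (fun i => ‖f i‖) fun i => ‖g i‖)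
  gcongr
  exact (norm_sum_le _ _).trans_eq (by simp)

/-- Controls the interpolating function on Re w = 0, where the powers of `τ` and `s` have modulus at
most 1. -/
lemma norm_bilinear_le_one {E : ι → κ → ℝ} (hE : IsContractionMatrix E) {g : ι → ℝ} {h : κ → ℝ}
    (hg : ∑ i, g i ^ 2 ≤ 1) (hh : ∑ j, h j ^ 2 ≤ 1) {t : ι → ℂ} {s : κ → ℂ}
    (ht : ∀ i, ‖t i‖ ≤ 1) (hs : ∀ j, ‖s j‖ ≤ 1) :
    ‖∑ i, ∑ j, (g i : ℂ) * t i * E i j * s j * h j‖ ≤ 1 := by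
  have h1 : ∑ i, ∑ j, (g i : ℂ) * t i * E i j * s j * h j
      = ∑ i, ((g i : ℂ) * t i) * ∑ j, (E i j : ℂ) * (s j * h j) := by
    simp only [Finset.mul_sum]
    exact Finset.sum_congr rfl fun i _ => Finset.sum_congr rfl fun j _ => by ring
  have hsq : ∀ (a : ℝ) (b : ℂ), ‖b‖ ≤ 1 → (|a| * ‖b‖) ^ 2 ≤ a ^ 2 := fun a b hb => by
    rw [mul_pow, sq_abs]
    exact mul_le_of_le_one_right (sq_nonneg _) (pow_le_one₀ (norm_nonneg _) hb)
  have h2 : ∑ i, ‖(g i : ℂ) * t i‖ ^ 2 ≤ 1 := by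
    refine le_trans (Finset.sum_le_sum fun i _ => ?_) hg
    simpa using hsq (g i) (t i) (ht i)
  have h3 : ∑ i, ‖∑ j, (E i j : ℂ) * (s j * h j)‖ ^ 2 ≤ 1 := by
    refine (hE.sum_norm_sq_le _).trans (le_trans (Finset.sum_le_sum fun j _ => ?_) hh)
    simpa [mul_comm] using hsq (h j) (s j) (hs j)
  have h4 := norm_sum_mul_sq_le Finset.univ (fun i => (g i : ℂ) * t i)
    (fun i => ∑ j, (E i j : ℂ) * (s j * h j))
  rw [h1]
  refine abs_le_one_iff_mul_self_le_one.2 ?_ |> (le_abs_self _).trans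
  rw [← sq]
  exact h4.trans (mul_le_one₀ h2 (Finset.sum_nonneg fun _ _ => sq_nonneg _) h3)

/-- Controls the interpolating function on Re w = 1: Cauchy–Schwarz for the Hilbert–Schmidt pairing
of `diag t * E * diag s` with `H * diag a * G`. -/
lemma norm_trilinear_sq_le {G : κ → ι → ℝ} {E : ι → η → ℝ} {H : η → κ → ℝ}
    (hG : ∀ k, ∑ i, G k i ^ 2 ≤ 1) (hH : IsContractionMatrix H)
    (a : κ → ℂ) (t : ι → ℂ) (s : η → ℂ) :
    ‖∑ k, a k * ∑ i, ∑ j, (G k i : ℂ) * t i * E i j * s j * H j k‖ ^ 2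
      ≤ (∑ i, ∑ j, ‖t i‖ ^ 2 * E i j ^ 2 * ‖s j‖ ^ 2) * ∑ k, ‖a k‖ ^ 2 := by
  have h1 : ∑ k, a k * ∑ i, ∑ j, (G k i : ℂ) * t i * E i j * s j * H j k
      = ∑ x : ι × η, (t x.1 * E x.1 x.2 * s x.2) * ∑ k, (H x.2 k : ℂ) * (a k * G k x.1) := by
    rw [Fintype.sum_prod_type]
    simp only [Finset.mul_sum]
    rw [Finset.sum_comm]
    refine Finset.sum_congr rfl fun i _ => ?_
    rw [Finset.sum_comm]
    exact Finset.sum_congr rfl fun j _ => Finset.sum_congr rfl fun k _ => by ring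
  rw [h1]
  refine (norm_sum_mul_sq_le _ _ _).trans ?_
  simp only [Fintype.sum_prod_type]
  refine mul_le_mul (le_of_eq (by simp [mul_pow])) ?_
    (Finset.sum_nonneg fun _ _ => Finset.sum_nonneg fun _ _ => sq_nonneg _)
    (Finset.sum_nonneg fun _ _ => Finset.sum_nonneg fun _ _ => by positivity)
  calc ∑ i, ∑ j, ‖∑ k, (H j k : ℂ) * (a k * G k i)‖ ^ 2
        ≤ ∑ i, ∑ k, ‖a k * G k i‖ ^ 2 := Finset.sum_le_sum fun i _ => hH.sum_norm_sq_le _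
      _ = ∑ k, ‖a k‖ ^ 2 * ∑ i, G k i ^ 2 := by
          rw [Finset.sum_comm]; simp [mul_pow, Finset.mul_sum]
      _ ≤ ∑ k, ‖a k‖ ^ 2 := Finset.sum_le_sum fun k _ =>
          mul_le_of_le_one_right (sq_nonneg _) (hG k)

/-- A form of the Araki–Lieb–Thirring inequality: if `σ k` is the `k`-th diagonal entry of
`G * diagonal τ * E * diagonal s * H`, then
`∑ σ ^ (2 q) ≤ tr (diagonal τ ^ (2 q) * E * diagonal s ^ (2 q) * Eᵀ)`. -/
theorem sum_rpow_le_of_factorization {G : κ → ι → ℝ} {E : ι → η → ℝ} {H : η → κ → ℝ}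
    (hG : ∀ k, ∑ i, G k i ^ 2 ≤ 1) (hE : IsContractionMatrix E) (hH : IsContractionMatrix H)
    {σ : κ → ℝ} {τ : ι → ℝ} {s : η → ℝ} (hσ : ∀ k, 0 ≤ σ k) (hτ : ∀ i, 0 ≤ τ i)
    (hs : ∀ j, 0 ≤ s j) {q : ℝ} (hq : 1 < q)
    (h : ∀ k, ∑ i, ∑ j, G k i * τ i * E i j * s j * H j k = σ k) :
    ∑ k, σ k ^ (2 * q) ≤ ∑ i, ∑ j, τ i ^ (2 * q) * E i j ^ 2 * s j ^ (2 * q) := by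
  set S := ∑ k, σ k ^ (2 * q) with hS
  set Q := ∑ i, ∑ j, τ i ^ (2 * q) * E i j ^ 2 * s j ^ (2 * q) with hQ
  have hQ0 : 0 ≤ Q := Finset.sum_nonneg fun i _ => Finset.sum_nonneg fun j _ => by
    have := hτ i; have := hs j; positivity
  have hS0 : 0 ≤ S := Finset.sum_nonneg fun k _ => Real.rpow_nonneg (hσ k) _
  rcases hS0.eq_or_lt with hS1 | hS1
  · rw [← hS1]; exact hQ0
  -- The exponents are chosen so that `F (1/q) = S`, while `|F| ≤ S` on Re w = 0 and `|F| ≤ √(Q S)`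
  -- on Re w = 1.
  let F : ℂ → ℂ := fun w => ∑ k, entirePow (σ k) (q * (2 - w)) *
    ∑ i, ∑ j, (G k i : ℂ) * entirePow (τ i) (q * w) * E i j * entirePow (s j) (q * w) * H j k
  have hq0 : 0 < q := by linarith
  have sq_rpow : ∀ {x : ℝ}, 0 ≤ x → (x ^ q) ^ 2 = x ^ (2 * q) := fun {x} hx => by
    rw [← Real.rpow_natCast, ← Real.rpow_mul hx, mul_comm]; norm_num
  have hdiff : Differentiable ℂ F := by
    have h1 : ∀ x : ℝ, Differentiable ℂ fun w : ℂ => entirePow x (q * (2 - w)) := fun x =>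
      (differentiable_entirePow x).comp (by fun_prop)
    have h2 : ∀ x : ℝ, Differentiable ℂ fun w : ℂ => entirePow x (q * w) := fun x =>
      (differentiable_entirePow x).comp (by fun_prop)
    refine Differentiable.fun_sum fun k _ => (h1 _).mul <| Differentiable.fun_sum fun i _ =>
      Differentiable.fun_sum fun j _ => ?_
    exact (((((h2 _).const_mul _)).mul_const _).mul (h2 _)).mul_const _
  have hbdd : BddAbove ((norm ∘ F) '' Complex.HadamardThreeLines.verticalClosedStrip 0 1) := by
    refine ⟨∑ k, (1 + σ k) ^ (2 * q) * ∑ i, ∑ j, |G k i| * (1 + τ i) ^ q * |E i j| *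
      (1 + s j) ^ q * |H j k|, ?_⟩
    rintro _ ⟨w, ⟨hw0, hw1⟩, rfl⟩
    have hn : ∀ {x : ℝ}, 0 ≤ x → ‖entirePow x (q * w)‖ ≤ (1 + x) ^ q := fun {x} hx =>
      norm_entirePow_le_one_add_rpow hx (by simpa using by positivity)
        (by simpa using mul_le_of_le_one_right hq0.le hw1)
    have hn' : ∀ {x : ℝ}, 0 ≤ x → ‖entirePow x (q * (2 - w))‖ ≤ (1 + x) ^ (2 * q) := fun {x} hx =>
      norm_entirePow_le_one_add_rpow hx
        (by simpa using mul_nonneg hq0.le (by linarith : (0 : ℝ) ≤ 2 - w.re))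
        (by
          have : q * (2 - w.re) ≤ q * 2 := by gcongr; linarith
          simpa [mul_comm] using this)
    refine (norm_sum_le _ _).trans (Finset.sum_le_sum fun k _ => ?_)
    rw [norm_mul]
    have h1 := hn' (hσ k)
    have hk := hσ k
    gcongr
    refine (norm_sum_le _ _).trans (Finset.sum_le_sum fun i _ => ?_)
    refine (norm_sum_le _ _).trans (Finset.sum_le_sum fun j _ => ?_)
    have hi := hτ i
    have hj := hs j
    have h2 := hn hi
    have h3 := hn hj
    simp only [norm_mul, Complex.norm_real, Real.norm_eq_abs]
    gcongr
  have hleft : ∀ w ∈ Complex.re ⁻¹' {(0 : ℝ)}, ‖F w‖ ≤ S := by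
    intro w hw
    have hw : w.re = 0 := hw
    refine (norm_sum_le _ _).trans (Finset.sum_le_sum fun k _ => ?_)
    rw [norm_mul]
    have h1 : ‖entirePow (σ k) (q * (2 - w))‖ ≤ σ k ^ (2 * q) := by
      simpa [hw, mul_comm] using norm_entirePow_le_rpow (hσ k) (q * (2 - w))
    refine (mul_le_of_le_one_right (norm_nonneg _) ?_).trans h1
    refine norm_bilinear_le_one hE (hG k) (hH.sum_sq_col_le k) (fun i => ?_) (fun j => ?_)
    · simpa [hw] using norm_entirePow_le_rpow (hτ i) (q * w)
    · simpa [hw] using norm_entirePow_le_rpow (hs j) (q * w)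
  have hright : ∀ w ∈ Complex.re ⁻¹' {(1 : ℝ)}, ‖F w‖ ≤ √(Q * S) := by
    intro w hw
    have hw : w.re = 1 := hw
    have hn : ∀ {x : ℝ}, 0 ≤ x → ‖entirePow x (q * w)‖ ^ 2 ≤ x ^ (2 * q) := fun {x} hx => by
      rw [← sq_rpow hx]
      gcongr
      simpa [hw] using norm_entirePow_le_rpow hx (q * w)
    refine Real.le_sqrt_of_sq_le ((norm_trilinear_sq_le hG hH _ _ _).trans ?_)
    refine mul_le_mul ?_ ?_ (Finset.sum_nonneg fun _ _ => sq_nonneg _) hQ0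
    · refine Finset.sum_le_sum fun i _ => Finset.sum_le_sum fun j _ => ?_
      have hi := hτ i
      have h2 := hn hi
      have h3 := hn (hs j)
      gcongr
    · refine Finset.sum_le_sum fun k _ => ?_
      rw [← sq_rpow (hσ k)]
      gcongr
      refine (norm_entirePow_le_rpow (hσ k) _).trans_eq ?_
      congr 1
      simp [hw]; ring
  have hmem : ((q⁻¹ : ℝ) : ℂ) ∈ Complex.HadamardThreeLines.verticalClosedStrip 0 1 :=
    ⟨by simpa using hq0.le, by simpa using inv_le_one_of_one_le₀ hq.le⟩
  have main := Complex.HadamardThreeLines.norm_le_interp_of_mem_verticalClosedStrip₀₁' F hmem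
    hdiff.diffContOnCl hbdd hleft hright
  have hF : F ((q⁻¹ : ℝ) : ℂ) = (S : ℂ) := by
    have e1 : (q : ℂ) * ((q⁻¹ : ℝ) : ℂ) = ((1 : ℝ) : ℂ) := by
      rw [← Complex.ofReal_mul, mul_inv_cancel₀ hq0.ne']
    have e2 : (q : ℂ) * (2 - ((q⁻¹ : ℝ) : ℂ)) = ((2 * q - 1 : ℝ) : ℂ) := by
      rw [mul_sub, e1]; push_cast; ring
    simp only [F, e1, e2, hS, Complex.ofReal_sum]
    refine Finset.sum_congr rfl fun k _ => ?_
    rw [entirePow_ofReal (hσ k) (by linarith)]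
    simp only [entirePow_ofReal (hτ _) one_ne_zero, entirePow_ofReal (hs _) one_ne_zero,
      Real.rpow_one]
    have : ∑ i, ∑ j, (G k i : ℂ) * τ i * E i j * s j * H j k = (σ k : ℂ) := by
      exact_mod_cast h k
    rw [this, ← Complex.ofReal_mul]
    congr 1
    rcases (hσ k).eq_or_lt with h0 | h0
    · rw [← h0, mul_zero, Real.zero_rpow (by linarith)]
    · rw [← Real.rpow_add_one h0.ne']; congr 1; ring
  rw [hF, Complex.ofReal_re, Complex.norm_real, Real.norm_of_nonneg hS0] at main
  -- The `q`-th power of the interpolated bound is S^q ≤ S^(q−1) √(Q S); cancelling powers of S > 0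
  -- leaves S ≤ Q.
  have h1 : S ^ q ≤ (S ^ (1 - q⁻¹) * √(Q * S) ^ q⁻¹) ^ q := by gcongr
  rw [Real.mul_rpow (by positivity) (by positivity), ← Real.rpow_mul hS0,
    Real.rpow_inv_rpow (by positivity) hq0.ne', sub_mul, inv_mul_cancel₀ hq0.ne', one_mul,
    Real.rpow_sub_one hS1.ne', div_mul_eq_mul_div, le_div_iff₀ hS1] at h1
  have h2 := le_of_mul_le_mul_left h1 (Real.rpow_pos_of_pos hS1 q)
  rw [Real.le_sqrt hS0 (by positivity), sq] at h2
  exact le_of_mul_le_mul_right h2 hS1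

end

open scoped InnerProductSpace

/-! ### Singular systems and the Araki–Lieb–Thirring inequality -/

section

variable {ι κ η V : Type*} [Fintype ι] [Fintype κ]
  [NormedAddCommGroup V] [InnerProductSpace ℝ V]

/-- Jensen's inequality for `x ↦ x ^ q` with weights of total mass at most one. -/
lemma rpow_sum_mul_le [Fintype η] {w x : η → ℝ} (hw : ∀ j, 0 ≤ w j) (hw1 : ∑ j, w j ≤ 1)
    (hx : ∀ j, 0 ≤ x j) {q : ℝ} (hq : 1 < q) :
    (∑ j, w j * x j) ^ q ≤ ∑ j, w j * x j ^ q := by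
  set g := ∑ j, w j * x j with hg
  have hg0 : 0 ≤ g := Finset.sum_nonneg fun j _ => mul_nonneg (hw j) (hx j)
  rcases hg0.eq_or_lt with h0 | h0
  · rw [← h0, Real.zero_rpow (by linarith)]
    exact Finset.sum_nonneg fun j _ => mul_nonneg (hw j) (Real.rpow_nonneg (hx j) _)
  -- Bernoulli's inequality: the power lies above its tangent at the mean `g`. Total mass below 1
  -- only helps, since q − (q − 1)∑w ≥ 1.
  have tangent : ∀ j, g ^ q * (1 + q * (x j / g - 1)) ≤ x j ^ q := fun j => by
    have h1 := one_add_mul_self_le_rpow_one_add (s := x j / g - 1)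
      (by have := div_nonneg (hx j) hg0; linarith) hq.le
    rw [add_sub_cancel, Real.div_rpow (hx j) hg0, le_div_iff₀ (by positivity)] at h1
    linarith
  have h2 : ∑ j, w j * (g ^ q * (1 + q * (x j / g - 1)))
      = g ^ q * (q - (q - 1) * ∑ j, w j) := by
    have : ∀ j, w j * (g ^ q * (1 + q * (x j / g - 1)))
        = g ^ q * (q / g * (w j * x j) - (q - 1) * w j) := fun j => by field_simp; ring
    simp only [this, ← Finset.mul_sum, Finset.sum_sub_distrib]
    rw [← hg]; field_simp
  have h3 : g ^ q * 1 ≤ g ^ q * (q - (q - 1) * ∑ j, w j) := by gcongr; nlinarith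
  calc g ^ q ≤ g ^ q * (q - (q - 1) * ∑ j, w j) := by linarith
    _ = _ := h2.symm
    _ ≤ _ := Finset.sum_le_sum fun j _ => mul_le_mul_of_nonneg_left (tangent j) (hw j)

/-- Testing the contraction on its own row `i` gives t² ≤ t. -/
lemma IsContractionMatrix.sum_sq_row_le [Fintype η] {E : ι → η → ℝ} (hE : IsContractionMatrix E) (i : ι) :
    ∑ j, E i j ^ 2 ≤ 1 := by
  set t := ∑ j, E i j ^ 2 with ht
  have h1 : t ^ 2 ≤ t := by
    refine le_trans ?_ (hE fun j => E i j)
    have := Finset.single_le_sum (f := fun i' => (∑ j, E i' j * E i j) ^ 2)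
      (fun _ _ => sq_nonneg _) (Finset.mem_univ i)
    simpa [ht, sq] using this
  nlinarith

lemma sq_div_mul_rpow_two_mul {s : ℝ} (hs : 0 ≤ s) {q : ℝ} (hq : 1 < q) (x : ℝ) :
    (x / s) ^ 2 * s ^ (2 * q) = x ^ 2 * s ^ (2 * q - 2) := by
  rcases hs.eq_or_lt with h0 | h0
  · rw [← h0, Real.zero_rpow (by linarith), Real.zero_rpow (by linarith)]; ring
  · rw [Real.rpow_sub h0, Real.rpow_two]; field_simp

/-- The vectors `h j` are right singular vectors, with singular values `s j`, of the map
`z ↦ (⟪N i, z⟫)_i`. -/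
def IsSingularSystem (N : ι → V) (h : η → V) (s : η → ℝ) : Prop :=
  ∀ j l, ∑ i, ⟪N i, h j⟫_ℝ * ⟪N i, h l⟫_ℝ = open Classical in if j = l then s j ^ 2 else 0

namespace IsSingularSystem

variable {N : ι → V} {h : η → V} {s : η → ℝ}

lemma sum_sq (H : IsSingularSystem N h s) (j : η) : ∑ i, ⟪N i, h j⟫_ℝ ^ 2 = s j ^ 2 := by
  simpa [sq] using H j j

/-- If `s j = 0` then every `⟪N i, h j⟫` vanishes, so division by zero loses nothing. -/
lemma inner_div_mul (H : IsSingularSystem N h s) (i : ι) (j : η) :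
    ⟪N i, h j⟫_ℝ / s j * s j = ⟪N i, h j⟫_ℝ := by
  refine div_mul_cancel_of_imp fun h0 => ?_
  have h1 := H.sum_sq j
  rw [h0, zero_pow two_ne_zero, Finset.sum_eq_zero_iff_of_nonneg fun _ _ => sq_nonneg _] at h1
  exact pow_eq_zero_iff two_ne_zero |>.1 (h1 i (Finset.mem_univ i))

/-- The normalised columns are orthonormal, or zero where `s j = 0`. -/
lemma isContractionMatrix [Fintype η] (H : IsSingularSystem N h s) :
    IsContractionMatrix fun i j => ⟪N i, h j⟫_ℝ / s j := by
  classical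
  intro c
  have h1 : ∑ i, (∑ j, ⟪N i, h j⟫_ℝ / s j * c j) ^ 2
      = ∑ j, ∑ l, (c j / s j) * (c l / s l) * ∑ i, ⟪N i, h j⟫_ℝ * ⟪N i, h l⟫_ℝ := by
    have h2 : ∀ i, (∑ j, ⟪N i, h j⟫_ℝ / s j * c j) ^ 2
        = ∑ j, ∑ l, (c j / s j) * (c l / s l) * (⟪N i, h j⟫_ℝ * ⟪N i, h l⟫_ℝ) := fun i => by
      rw [sq, Finset.sum_mul_sum]
      exact Finset.sum_congr rfl fun j _ => Finset.sum_congr rfl fun l _ => by ring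
    simp only [h2, Finset.mul_sum]
    rw [Finset.sum_comm]
    exact Finset.sum_congr rfl fun j _ => Finset.sum_comm
  rw [h1]
  refine Finset.sum_le_sum fun j _ => ?_
  have h2 : ∀ l, ∑ i, ⟪N i, h j⟫_ℝ * ⟪N i, h l⟫_ℝ = if j = l then s j ^ 2 else 0 := fun l => by
    rw [H j l]
  simp only [h2, mul_ite, mul_zero, Finset.sum_ite_eq, Finset.mem_univ, if_true]
  rcases eq_or_ne (s j) 0 with h0 | h0
  · simp [h0, sq_nonneg]
  · exact le_of_eq (by field_simp)

/-- Hölder's inequality for the diagonal entries of powers of `N * Nᵀ`. -/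
lemma norm_rpow_le [Fintype η] (H : IsSingularSystem N h s) (hs : ∀ j, 0 ≤ s j) {q : ℝ} (hq : 1 < q) (i : ι) :
    (∑ j, ⟪N i, h j⟫_ℝ ^ 2) ^ q ≤ ∑ j, ⟪N i, h j⟫_ℝ ^ 2 * s j ^ (2 * q - 2) := by
  have h1 := rpow_sum_mul_le (w := fun j => (⟪N i, h j⟫_ℝ / s j) ^ 2) (x := fun j => s j ^ 2)
    (fun _ => sq_nonneg _) (H.isContractionMatrix.sum_sq_row_le i) (fun _ => sq_nonneg _) hq
  have h2 : ∀ j, (s j ^ 2) ^ q = s j ^ (2 * q) := fun j => by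
    rw [← Real.rpow_two, ← Real.rpow_mul (hs j)]
  simp only [h2, sq_div_mul_rpow_two_mul (hs _) hq] at h1
  simpa only [← mul_pow, H.inner_div_mul] using h1

end IsSingularSystem

/-- The Araki–Lieb–Thirring inequality for the matrix `∑ i, τ i ^ 2 • N i (N i)ᵀ`. -/
theorem sum_rpow_le_of_isSingularSystem [Fintype η] {N : ι → V} (e : OrthonormalBasis κ ℝ V)
    (h : OrthonormalBasis η ℝ V) {σ : κ → ℝ} {τ : ι → ℝ} {s : η → ℝ} (hσ : ∀ k, 0 ≤ σ k)
    (hτ : ∀ i, 0 ≤ τ i) (hs : ∀ j, 0 ≤ s j) {q : ℝ} (hq : 1 < q)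
    (hσN : ∀ k, ∑ i, (τ i * ⟪N i, e k⟫_ℝ) ^ 2 = σ k ^ 2) (H : IsSingularSystem N h s) :
    ∑ k, σ k ^ (2 * q) ≤ ∑ i, ∑ j, τ i ^ (2 * q) * (⟪N i, h j⟫_ℝ ^ 2 * s j ^ (2 * q - 2)) := by
  -- `E * diag s` holds the coordinates of the `N i` in the basis `h`, `H` changes basis from `e` to
  -- `h`, and `G k` is the vector (τ i ⟪N i, e k⟫)_i normalised, or zero when `σ k = 0`.
  have main := sum_rpow_le_of_factorization (G := fun k i => τ i * ⟪N i, e k⟫_ℝ / σ k)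
    (E := fun i j => ⟪N i, h j⟫_ℝ / s j) (H := fun j k => ⟪h j, e k⟫_ℝ) (σ := σ) (τ := τ) (s := s)
    ?_ H.isContractionMatrix ?_ hσ hτ hs hq ?_
  · simpa only [mul_assoc, sq_div_mul_rpow_two_mul (hs _) hq] using main
  · intro k
    simp only [div_pow, ← Finset.sum_div, hσN]
    exact div_self_le_one _
  · intro c
    have h1 : ∀ j, ∑ k, ⟪h j, e k⟫_ℝ * c k = ⟪h j, ∑ k, c k • e k⟫_ℝ := fun j => by
      simp [inner_sum, inner_smul_right, mul_comm]
    simp only [h1]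
    refine le_of_eq ?_
    have h2 := h.sum_sq_norm_inner_right (∑ k, c k • e k)
    have h3 := e.sum_sq_norm_inner_right (∑ k, c k • e k)
    simp only [e.orthonormal.inner_right_fintype, Real.norm_eq_abs, sq_abs] at h2 h3
    rw [h2, h3]
  · intro k
    have h1 : ∀ i, ∑ j, τ i * ⟪N i, e k⟫_ℝ / σ k * τ i * (⟪N i, h j⟫_ℝ / s j) * s j * ⟪h j, e k⟫_ℝ
        = (τ i * ⟪N i, e k⟫_ℝ) ^ 2 / σ k := fun i => by
      have h2 : ∀ j, τ i * ⟪N i, e k⟫_ℝ / σ k * τ i * (⟪N i, h j⟫_ℝ / s j) * s j * ⟪h j, e k⟫_ℝ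
          = τ i * ⟪N i, e k⟫_ℝ / σ k * τ i * (⟪N i, h j⟫_ℝ * ⟪h j, e k⟫_ℝ) := fun j => by
        rw [mul_assoc (_ * _) _ (s j), H.inner_div_mul, mul_assoc]
      simp only [h2, ← Finset.mul_sum, h.sum_inner_mul_inner]
      ring
    simp only [h1]
    rw [← Finset.sum_div, hσN, sq, mul_self_div_self]

end

/-! ### Comparison with the 2 × 2 triangular matrix -/

section

variable {ξ κ V : Type*} [Fintype ξ] [Fintype κ] [NormedAddCommGroup V] [InnerProductSpace ℝ V]

lemma EuclideanSpace.inner_fin_two (x y : EuclideanSpace ℝ (Fin 2)) :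
    ⟪x, y⟫_ℝ = x 0 * y 0 + x 1 * y 1 := by
  simp [PiLp.inner_apply, Fin.sum_univ_two, mul_comm]

/-- The two rows of an orthogonal `2 × 2` matrix are orthonormal when its columns are. -/
lemma OrthonormalBasis.sum_apply_mul_apply
    (r : OrthonormalBasis (Fin 2) ℝ (EuclideanSpace ℝ (Fin 2)))
    (i i' : Fin 2) : ∑ j, r j i * r j i' = if i = i' then 1 else 0 := by
  have := r.sum_inner_mul_inner (EuclideanSpace.single i (1 : ℝ)) (EuclideanSpace.single i' 1)
  simpa [EuclideanSpace.inner_single_left, EuclideanSpace.inner_single_right, Pi.single_apply,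
    eq_comm] using this

/-- If `r` is an orthonormal basis of the plane and `u`, `b` are orthonormal, then the vectors
`r j 0 • u + r j 1 • b` extend to an orthonormal basis. -/
lemma exists_orthonormalBasis_extending_plane [FiniteDimensional ℝ V] {m : ℕ}
    (hm : Module.finrank ℝ V = m + 2) {u b : V} (hu : ‖u‖ = 1) (hb : ‖b‖ = 1)
    (hub : ⟪u, b⟫_ℝ = 0) (r : OrthonormalBasis (Fin 2) ℝ (EuclideanSpace ℝ (Fin 2))) :
    ∃ h : OrthonormalBasis (Fin 2 ⊕ Fin m) ℝ V, (∀ j, h (.inl j) = r j 0 • u + r j 1 • b) ∧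
      (∀ l, ⟪u, h (.inr l)⟫_ℝ = 0) ∧ ∀ l, ⟪b, h (.inr l)⟫_ℝ = 0 := by
  have huu : ⟪u, u⟫_ℝ = 1 := by rw [real_inner_self_eq_norm_sq, hu]; norm_num
  have hbb : ⟪b, b⟫_ℝ = 1 := by rw [real_inner_self_eq_norm_sq, hb]; norm_num
  have hbu : ⟪b, u⟫_ℝ = 0 := by rw [real_inner_comm, hub]
  let w : Fin 2 ⊕ Fin m → V := Sum.elim (fun j => r j 0 • u + r j 1 • b) 0
  have hw : Orthonormal ℝ ((Set.range Sum.inl).domRestrict w) := by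
    rw [orthonormal_iff_ite]
    rintro ⟨_, j, rfl⟩ ⟨_, l, rfl⟩
    have h1 := orthonormal_iff_ite.1 r.orthonormal j l
    rw [EuclideanSpace.inner_fin_two] at h1
    simp only [Set.domRestrict_apply, w, Sum.elim_inl, inner_add_left, inner_add_right,
      real_inner_smul_left, real_inner_smul_right, huu, hbb, hub, hbu]
    have h2 : (⟨Sum.inl j, Set.mem_range_self j⟩ : Set.range (Sum.inl : Fin 2 → Fin 2 ⊕ Fin m))
        = ⟨.inl l, Set.mem_range_self l⟩ ↔ j = l :=
      Subtype.ext_iff.trans Sum.inl_injective.eq_iff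
    refine Eq.trans ?_ (h1.trans (if_congr h2.symm rfl rfl))
    ring
  obtain ⟨h, hh⟩ := hw.exists_orthonormalBasis_extension_of_card_eq (by simp [hm, add_comm])
  have hinl : ∀ j, h (.inl j) = r j 0 • u + r j 1 • b := fun j => hh _ ⟨j, rfl⟩
  -- Orthonormality of the rows of `r` recovers `u` and `b` from the vectors `h (.inl j)`.
  have expand : ∀ (i : Fin 2) (z : V), (∀ j, ⟪h (.inl j), z⟫_ℝ = 0) →
      (∑ j, r j i * r j 0) * ⟪u, z⟫_ℝ + (∑ j, r j i * r j 1) * ⟪b, z⟫_ℝ = 0 := by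
    intro i z hz
    simp only [hinl, inner_add_left, real_inner_smul_left] at hz
    simp only [Fin.sum_univ_two]
    linear_combination r 0 i * hz 0 + r 1 i * hz 1
  have orth : ∀ l j, ⟪h (.inl j), h (.inr l)⟫_ℝ = 0 := fun l j =>
    h.orthonormal.inner_eq_zero (by simp)
  simp only [r.sum_apply_mul_apply] at expand
  exact ⟨h, hinl, fun l => by simpa using expand 0 _ (orth l),
    fun l => by simpa using expand 1 _ (orth l)⟩

lemma sum_rpow_mul_le {τ f : ξ → ℝ} {Z p : ℝ} (hτ : ∀ i, 0 ≤ τ i) (hτ1 : ∑ i, τ i ^ p ≤ 1)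
    (hf : ∀ i, f i ≤ Z) (hZ : 0 ≤ Z) : ∑ i, τ i ^ p * f i ≤ Z :=
  calc ∑ i, τ i ^ p * f i ≤ ∑ i, τ i ^ p * Z := Finset.sum_le_sum fun i _ =>
        mul_le_mul_of_nonneg_left (hf i) (Real.rpow_nonneg (hτ i) _)
    _ = (∑ i, τ i ^ p) * Z := by rw [Finset.sum_mul]
    _ ≤ 1 * Z := by gcongr
    _ = Z := one_mul Z

/-- The comparison with a `2 × 2` triangular matrix, for the quadratic form
`⟪a u + β b, ·⟫² + ∑ i, (γ τ i ⟪x i, P ·⟫)²`, where `P` is the projection onto `uᗮ`. -/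
theorem sum_rpow_le_of_plane [FiniteDimensional ℝ V] {m : ℕ}
    (hm : Module.finrank ℝ V = m + 2) {u b : V} (hu : ‖u‖ = 1) (hb : ‖b‖ = 1)
    (hub : ⟪u, b⟫_ℝ = 0) {a β γ : ℝ} (hγ : 0 ≤ γ) (x : OrthonormalBasis ξ ℝ V)
    (e : OrthonormalBasis κ ℝ V) {σ : κ → ℝ} {τ : ξ → ℝ} (hσ : ∀ k, 0 ≤ σ k)
    (hτ : ∀ i, 0 ≤ τ i) {q : ℝ} (hq : 1 < q) (hτ1 : ∑ i, τ i ^ (2 * q) ≤ 1)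
    (hform : ∀ k, ⟪a • u + β • b, e k⟫_ℝ ^ 2
      + ∑ i, (τ i * (γ * ⟪x i, e k - ⟪u, e k⟫_ℝ • u⟫_ℝ)) ^ 2 = σ k ^ 2)
    (r : OrthonormalBasis (Fin 2) ℝ (EuclideanSpace ℝ (Fin 2))) {s : Fin 2 → ℝ}
    (hs : ∀ j, 0 ≤ s j)
    (hr : IsSingularSystem ![!₂[a, β], !₂[0, γ]] r s) :
    ∑ k, σ k ^ (2 * q) ≤ ∑ j, s j ^ (2 * q) := by
  obtain ⟨h, hinl, hinru, hinrb⟩ := exists_orthonormalBasis_extending_plane hm hu hb hub r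
  have huu : ⟪u, u⟫_ℝ = 1 := by rw [real_inner_self_eq_norm_sq, hu]; norm_num
  have hbb : ⟪b, b⟫_ℝ = 1 := by rw [real_inner_self_eq_norm_sq, hb]; norm_num
  have hbu : ⟪b, u⟫_ℝ = 0 := by rw [real_inner_comm, hub]
  have gram : ∀ j l, (a * r j 0 + β * r j 1) * (a * r l 0 + β * r l 1)
      + γ * r j 1 * (γ * r l 1) = if j = l then s j ^ 2 else 0 := fun j l => by
    have := hr j l
    simp only [Fin.sum_univ_two, EuclideanSpace.inner_fin_two] at this
    simp at this
    convert this
  -- `none` indexes the row a u + β b; the other rows carry γ, and the weights τ are kept outside.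
  let N : Option ξ → V := fun o => o.elim (a • u + β • b) fun i => γ • (x i - ⟪u, x i⟫_ℝ • u)
  have hN : ∀ i z, ⟪N (some i), z⟫_ℝ = γ * ⟪x i, z - ⟪u, z⟫_ℝ • u⟫_ℝ := fun i z => by
    simp only [N, Option.elim, real_inner_smul_left, inner_sub_left, inner_sub_right,
      real_inner_smul_right, real_inner_comm (x i) u]
    ring
  have hNl : ∀ j, ⟪N none, h (.inl j)⟫_ℝ = a * r j 0 + β * r j 1 := fun j => by
    simp only [N, hinl, Option.elim, inner_add_left, inner_add_right, real_inner_smul_left,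
      real_inner_smul_right, huu, hbb, hub, hbu]
    ring
  have hNr : ∀ l, ⟪N none, h (.inr l)⟫_ℝ = 0 := fun l => by
    simp [N, inner_add_left, real_inner_smul_left, hinru, hinrb]
  have hPl : ∀ j, h (.inl j) - ⟪u, h (.inl j)⟫_ℝ • u = r j 1 • b := fun j => by
    rw [hinl, inner_add_right, real_inner_smul_right, real_inner_smul_right, huu, hub]
    simp
  have hPr : ∀ l, h (.inr l) - ⟪u, h (.inr l)⟫_ℝ • u = h (.inr l) := fun l => by simp [hinru]
  have hsum : ∀ z w : V, ∑ i, γ * ⟪x i, z⟫_ℝ * (γ * ⟪x i, w⟫_ℝ) = γ ^ 2 * ⟪z, w⟫_ℝ := fun z w => by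
    rw [← x.sum_inner_mul_inner z w, Finset.mul_sum]
    exact Finset.sum_congr rfl fun i _ => by rw [real_inner_comm z]; ring
  -- Without the weights the form is ⟨y,·⟩² + γ²‖P·‖², which splits along the plane of `u`, `b` and
  -- its complement.
  have hsing : IsSingularSystem N h (Sum.elim s fun _ => γ) := by
    rintro (j | j) (l | l)
    · rw [Fintype.sum_option]
      simp only [hN, hPl, hsum, hNl]
      simp only [real_inner_smul_left, real_inner_smul_right, hbb, Sum.inl.injEq, Sum.elim_inl]
      rw [← gram]; ring
    · rw [Fintype.sum_option]
      simp only [hN, hPl, hPr, hsum, hNr]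
      simp [real_inner_smul_left, hinrb]
    · rw [Fintype.sum_option]
      simp only [hN, hPl, hPr, hsum, hNr]
      simp [real_inner_smul_right, real_inner_comm b, hinrb]
    · rw [Fintype.sum_option]
      simp only [hN, hPr, hsum, hNr, orthonormal_iff_ite.1 h.orthonormal]
      simp
  have main := sum_rpow_le_of_isSingularSystem (τ := fun o : Option ξ => o.elim 1 τ) e h hσ
    (by rintro (_ | i) <;> simp [hτ]) (by rintro (j | l) <;> simp [hs, hγ]) hq
    (fun k => by
      rw [Fintype.sum_option]
      simp only [hN, Option.elim, one_mul]
      exact hform k) hsing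
  refine main.trans ?_
  rw [Fintype.sum_option]
  simp only [Fintype.sum_sum_type, hN, hPl, hPr, hNl, hNr, real_inner_smul_right, Option.elim,
    Sum.elim_inl, Sum.elim_inr, Real.one_rpow, one_mul, ← Finset.mul_sum]
  set Z := ∑ j, (γ * r j 1) ^ 2 * s j ^ (2 * q - 2) with hZ
  have hγZ : γ ^ (2 * q) ≤ Z := by
    -- Row 1 of the triangular matrix has squared norm γ², so Jensen gives γ^{2q} ≤ Z.
    have h1 := hr.norm_rpow_le hs hq 1
    simp only [EuclideanSpace.inner_fin_two] at h1
    simp only [Matrix.cons_val_one, Matrix.cons_val_fin_one, PiLp.toLp_apply, Matrix.cons_val_zero,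
      zero_mul, zero_add, mul_pow, ← Finset.mul_sum] at h1
    have h2 := r.sum_apply_mul_apply 1 1
    simp only [← sq, if_true] at h2
    rw [h2, mul_one, ← Real.rpow_two, ← Real.rpow_mul hγ, Real.rpow_two] at h1
    simpa only [hZ, mul_pow] using h1
  have hZ0 : 0 ≤ Z := (Real.rpow_nonneg hγ _).trans hγZ
  -- The left side is ⟨x_i,b⟩² Z plus the squared mass of x_i off the plane times γ^{2q}; these
  -- weights sum to at most 1.
  have hbound : ∀ i, ∑ j, (γ * (r j 1 * ⟪x i, b⟫_ℝ)) ^ 2 * s j ^ (2 * q - 2)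
      + ∑ l, (γ * ⟪x i, h (.inr l)⟫_ℝ) ^ 2 * γ ^ (2 * q - 2) ≤ Z := by
    intro i
    have h1 : ∑ j, (γ * (r j 1 * ⟪x i, b⟫_ℝ)) ^ 2 * s j ^ (2 * q - 2) = ⟪x i, b⟫_ℝ ^ 2 * Z := by
      rw [hZ, Finset.mul_sum]
      exact Finset.sum_congr rfl fun j _ => by ring
    have h2 : γ ^ 2 * γ ^ (2 * q - 2) = γ ^ (2 * q) := by
      rcases hγ.eq_or_lt with h0 | h0
      · rw [← h0, Real.zero_rpow (by linarith : 2 * q ≠ 0)]; ring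
      · rw [Real.rpow_sub h0, Real.rpow_two]; field_simp
    have h3 : ∑ l, (γ * ⟪x i, h (.inr l)⟫_ℝ) ^ 2 * γ ^ (2 * q - 2)
        = (∑ l, ⟪x i, h (.inr l)⟫_ℝ ^ 2) * γ ^ (2 * q) := by
      rw [Finset.sum_mul, ← h2]
      exact Finset.sum_congr rfl fun j _ => by ring
    have h4 : ⟪x i, b⟫_ℝ ^ 2 + ∑ l, ⟪x i, h (.inr l)⟫_ℝ ^ 2 ≤ 1 := by
      have h5 := h.sum_sq_norm_inner_left (x i)
      simp only [Fintype.sum_sum_type, x.norm_eq_one, hinl, Real.norm_eq_abs, sq_abs,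
        inner_add_right, real_inner_smul_right, Fin.sum_univ_two, one_pow] at h5
      have h00 := r.sum_apply_mul_apply 0 0
      have h01 := r.sum_apply_mul_apply 0 1
      have h11 := r.sum_apply_mul_apply 1 1
      simp [Fin.sum_univ_two] at h00 h01 h11
      have h6 := sq_nonneg ⟪x i, u⟫_ℝ
      linear_combination h5 + h6 - ⟪x i, u⟫_ℝ ^ 2 * h00 - ⟪x i, b⟫_ℝ ^ 2 * h11
        - 2 * ⟪x i, u⟫_ℝ * ⟪x i, b⟫_ℝ * h01
    rw [h1, h3]
    have h7 : (∑ l, ⟪x i, h (.inr l)⟫_ℝ ^ 2) * γ ^ (2 * q)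
        ≤ (∑ l, ⟪x i, h (.inr l)⟫_ℝ ^ 2) * Z :=
      mul_le_mul_of_nonneg_left hγZ (Finset.sum_nonneg fun _ _ => sq_nonneg _)
    nlinarith
  have hlast := sum_rpow_mul_le hτ hτ1 hbound hZ0
  -- Adding the two diagonal entries column by column yields the trace.
  have hfinal : ∀ j, (a * r j 0 + β * r j 1) ^ 2 * s j ^ (2 * q - 2)
      + (γ * r j 1) ^ 2 * s j ^ (2 * q - 2) = s j ^ (2 * q) := fun j => by
    have h1 := gram j j
    rw [if_pos rfl] at h1
    rcases (hs j).eq_or_lt with h0 | h0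
    · rw [← h0, Real.zero_rpow (by linarith), Real.zero_rpow (by linarith)]; ring
    · rw [Real.rpow_sub h0, Real.rpow_two, ← add_mul, sq, sq, h1]; field_simp
  simp only [← hfinal, Finset.sum_add_distrib]
  simp only [ne_eq, OfNat.ofNat_ne_zero, not_false_eq_true, zero_pow, zero_mul, add_zero]
  linarith

end

/-! ### From matrices to quadratic forms -/

section

variable {n d : ℕ}

lemma exists_singularValueDecomposition (M : Matrix (Fin n) (Fin d) ℝ) :
    ∃ (e : OrthonormalBasis (Fin d) ℝ (EuclideanSpace ℝ (Fin d))) (σ : Fin d → ℝ),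
      (∀ k, 0 ≤ σ k) ∧
      (∀ k z, ⟪Matrix.toEuclideanLin M (e k), Matrix.toEuclideanLin M z⟫_ℝ
        = σ k ^ 2 * ⟪e k, z⟫_ℝ) ∧
      ∀ p, schattenNorm p M = (∑ k, σ k ^ p) ^ (1 / p) := by
  set T := Matrix.toEuclideanLin M with hT
  have hd : Module.finrank ℝ (EuclideanSpace ℝ (Fin d)) = d := finrank_euclideanSpace_fin
  refine ⟨T.isSymmetric_adjoint_comp_self.eigenvectorBasis hd, fun k => T.singularValues k,
    fun k => T.singularValues_nonneg k, fun k z => ?_, fun p => ?_⟩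
  · have h := T.isSymmetric_adjoint_comp_self.apply_eigenvectorBasis hd k
    rw [← T.sq_singularValues_fin hd k] at h
    rw [← LinearMap.adjoint_inner_left, ← LinearMap.comp_apply, h]
    simp [real_inner_smul_left]
  · rw [schattenNorm, Finset.sum_range]

lemma norm_sq_toEuclideanLin_apply {M : Matrix (Fin n) (Fin d) ℝ}
    {e : OrthonormalBasis (Fin d) ℝ (EuclideanSpace ℝ (Fin d))} {σ : Fin d → ℝ}
    (h : ∀ k z, ⟪Matrix.toEuclideanLin M (e k), Matrix.toEuclideanLin M z⟫_ℝ
        = σ k ^ 2 * ⟪e k, z⟫_ℝ) (z : EuclideanSpace ℝ (Fin d)) :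
    ‖Matrix.toEuclideanLin M z‖ ^ 2 = ∑ k, (σ k * ⟪e k, z⟫_ℝ) ^ 2 := by
  rw [← real_inner_self_eq_norm_sq]
  nth_rw 1 [← e.sum_repr z]
  simp only [map_sum, map_smul, sum_inner, real_inner_smul_left, h, e.repr_apply_apply]
  exact Finset.sum_congr rfl fun k _ => by ring

/-- The Schatten norms of the rank one matrix `v wᵀ` with `‖v‖ = 1` all equal `‖w‖`. -/
lemma schattenNorm_of_apply_eq_inner_smul {M : Matrix (Fin n) (Fin d) ℝ} {p : ℝ} (hp : 2 < p)
    {v : EuclideanSpace ℝ (Fin n)} (hv : ‖v‖ = 1) (w : EuclideanSpace ℝ (Fin d))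
    (hM : ∀ z, Matrix.toEuclideanLin M z = ⟪w, z⟫_ℝ • v) : schattenNorm p M = ‖w‖ := by
  obtain ⟨e, σ, hσ, hgram, hS⟩ := exists_singularValueDecomposition M
  have hvv : ⟪v, v⟫_ℝ = 1 := by rw [real_inner_self_eq_norm_sq, hv]; norm_num
  have key : ∀ k l, ⟪w, e k⟫_ℝ * ⟪w, e l⟫_ℝ = if k = l then σ k ^ 2 else 0 := fun k l => by
    have := hgram k (e l)
    rw [hM, hM, real_inner_smul_left, real_inner_smul_right, hvv,
      orthonormal_iff_ite.1 e.orthonormal] at this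
    simpa using this
  have hw : ∑ k, σ k ^ 2 = ‖w‖ ^ 2 := by
    have h1 := e.sum_sq_norm_inner_left w
    rw [← h1]
    refine Finset.sum_congr rfl fun k _ => ?_
    have h2 := key k k
    rw [if_pos rfl] at h2
    rw [← h2, Real.norm_eq_abs, sq_abs, sq]
  -- By `key` at most one coordinate of `w` in the basis `e` is nonzero, so at most one `σ k` is,
  -- and it carries the whole norm.
  have hor : ∀ k, σ k = 0 ∨ σ k = ‖w‖ := fun k => by
    refine or_iff_not_imp_left.2 fun h0 => ?_
    have h1 : ∑ l, σ l ^ 2 = σ k ^ 2 := by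
      refine Finset.sum_eq_single k (fun l _ hlk => ?_) (by simp)
      have h2 := key k k
      have h3 := key k l
      have h4 := key l l
      rw [if_pos rfl] at h2 h4
      rw [if_neg hlk.symm] at h3
      have h5 : ⟪w, e k⟫_ℝ ≠ 0 := fun h => h0 (by simpa [h] using h2.symm)
      rw [← h4, (mul_eq_zero.1 h3).resolve_left h5, zero_mul]
    rw [← sq_eq_sq₀ (hσ k) (norm_nonneg _), ← hw, h1]
  have hp0 : p ≠ 0 := by linarith
  have hsum : ∑ k, σ k ^ p = ‖w‖ ^ p := by
    have h1 : ∀ k, σ k ^ p = σ k ^ 2 * ‖w‖ ^ (p - 2) := fun k => by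
      rcases hor k with h | h
      · rw [h, Real.zero_rpow hp0]; ring
      · rw [h]
        rcases (norm_nonneg w).eq_or_lt with h0 | h0
        · rw [← h0, Real.zero_rpow hp0]; ring
        · rw [Real.rpow_sub h0, Real.rpow_two]; field_simp
    simp only [h1, ← Finset.sum_mul, hw]
    rcases (norm_nonneg w).eq_or_lt with h0 | h0
    · rw [← h0, Real.zero_rpow hp0]; ring
    · rw [Real.rpow_sub h0, Real.rpow_two]; field_simp
  rw [hS, hsum, one_div, Real.rpow_rpow_inv (norm_nonneg _) hp0]

lemma toEuclideanLin_outerSelf_apply (v z : EuclideanSpace ℝ (Fin n)) :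
    Matrix.toEuclideanLin (outerSelf v) z = ⟪v, z⟫_ℝ • v := by
  ext i
  simp [outerSelf, Matrix.vecMulVec_mulVec, PiLp.inner_apply, dotProduct, mul_comm]

lemma toEuclideanLin_mul_mul_apply (B : Matrix (Fin n) (Fin n) ℝ) (A : Matrix (Fin n) (Fin d) ℝ)
    (C : Matrix (Fin d) (Fin d) ℝ) (z : EuclideanSpace ℝ (Fin d)) :
    Matrix.toEuclideanLin (B * A * C) z
      = Matrix.toEuclideanLin B (Matrix.toEuclideanLin A (Matrix.toEuclideanLin C z)) := by
  ext i
  simp [Matrix.mulVec_mulVec, Matrix.mul_assoc]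

lemma toEuclideanLin_one_sub_outerSelf_apply (v z : EuclideanSpace ℝ (Fin n)) :
    Matrix.toEuclideanLin (1 - outerSelf v) z = z - ⟪v, z⟫_ℝ • v := by
  rw [map_sub, LinearMap.sub_apply, toEuclideanLin_outerSelf_apply]
  simp

/-- The block matrix comparison, in terms of the linear map of `A`. -/
theorem schattenNorm_le_of_blocks {A C : Matrix (Fin n) (Fin d) ℝ} {p : ℝ} (hp : 2 < p)
    {u b : EuclideanSpace ℝ (Fin d)} (hu : ‖u‖ = 1) (hb : ‖b‖ = 1) (hub : ⟪u, b⟫_ℝ = 0) {a β : ℝ}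
    (hA : ∀ z, ‖Matrix.toEuclideanLin A z‖ ^ 2
      = ⟪a • u + β • b, z⟫_ℝ ^ 2 + ‖Matrix.toEuclideanLin C (z - ⟪u, z⟫_ℝ • u)‖ ^ 2)
    {m : ℕ} (hd : d = m + 2) :
    schattenNorm p A ≤ schattenNorm p !![a, β; 0, schattenNorm p C] := by
  obtain ⟨e, σ, hσ, hσA, hSA⟩ := exists_singularValueDecomposition A
  obtain ⟨x, c, hc, hcC, hSC⟩ := exists_singularValueDecomposition C
  set γ := schattenNorm p C with hγdef
  have hp0 : p ≠ 0 := by linarith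
  have hcp : 0 ≤ ∑ i, c i ^ p := Finset.sum_nonneg fun i _ => Real.rpow_nonneg (hc i) _
  have hγ : 0 ≤ γ := by rw [hγdef, hSC]; exact Real.rpow_nonneg hcp _
  have hγp : γ ^ p = ∑ i, c i ^ p := by
    rw [hγdef, hSC, one_div, Real.rpow_inv_rpow hcp hp0]
  obtain ⟨r, s, hs, hsT, hST⟩ := exists_singularValueDecomposition !![a, β; 0, γ]
  have hr : IsSingularSystem ![!₂[a, β], !₂[0, γ]] r s := by
    intro j l
    have h1 := hsT j (r l)
    rw [orthonormal_iff_ite.1 r.orthonormal, EuclideanSpace.inner_fin_two] at h1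
    simp [Matrix.mulVec, dotProduct, Fin.sum_univ_two] at h1
    simp only [Fin.sum_univ_two, EuclideanSpace.inner_fin_two]
    simp
    convert h1
  -- If γ = 0 then every `c i` is zero, so the weights c_i/γ still reproduce `c`.
  have hγτ : ∀ i, c i / γ * γ = c i := fun i => by
    refine div_mul_cancel_of_imp fun h0 => ?_
    rw [h0, Real.zero_rpow hp0, eq_comm,
      Finset.sum_eq_zero_iff_of_nonneg fun i _ => Real.rpow_nonneg (hc i) _] at hγp
    exact (Real.rpow_eq_zero (hc i) hp0).1 (hγp i (Finset.mem_univ i))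
  have hq : 2 * (p / 2) = p := by ring
  have main := sum_rpow_le_of_plane (by rw [finrank_euclideanSpace_fin, hd]) hu hb hub
    (a := a) (β := β) hγ x e (τ := fun i => c i / γ) hσ (fun i => div_nonneg (hc i) hγ)
    (q := p / 2) (by linarith) ?_ ?_ r hs hr
  · rw [hq] at main
    rw [hSA, hST]
    exact Real.rpow_le_rpow (Finset.sum_nonneg fun k _ => Real.rpow_nonneg (hσ k) _) main
      (by positivity)
  · simp only [hq, Real.div_rpow (hc _) hγ, ← Finset.sum_div, hγp]
    exact div_self_le_one _
  · intro k
    simp only [← mul_assoc, hγτ]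
    rw [← norm_sq_toEuclideanLin_apply hcC, ← hA, ← real_inner_self_eq_norm_sq, hσA,
      orthonormal_iff_ite.1 e.orthonormal, if_pos rfl, mul_one]

lemma exists_unit_vector_orthogonal {m : ℕ} {u : EuclideanSpace ℝ (Fin (m + 2))} (hu : ‖u‖ = 1)
    {w : EuclideanSpace ℝ (Fin (m + 2))} (hw : ⟪u, w⟫_ℝ = 0) :
    ∃ b : EuclideanSpace ℝ (Fin (m + 2)), ‖b‖ = 1 ∧ ⟪u, b⟫_ℝ = 0 ∧ ‖w‖ • b = w := by
  rcases eq_or_ne w 0 with rfl | h0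
  · have h1 : Orthonormal ℝ (({0} : Set (Fin (m + 2))).domRestrict fun _ => u) := by
      refine ⟨fun _ => hu, fun i j hij => absurd (Subsingleton.elim i j) hij⟩
    obtain ⟨h, hh⟩ := h1.exists_orthonormalBasis_extension_of_card_eq (by simp)
    refine ⟨h 1, h.norm_eq_one 1, ?_, by simp⟩
    rw [← hh 0 rfl]
    exact h.orthonormal.inner_eq_zero (by simp)
  · have h1 : ‖w‖ ≠ 0 := norm_ne_zero_iff.2 h0
    refine ⟨‖w‖⁻¹ • w, by simp [norm_smul, h1], by simp [real_inner_smul_right, hw], ?_⟩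
    rw [smul_smul, mul_inv_cancel₀ h1, one_smul]

end

/-! ### Computing the blocks and concluding -/

theorem lemma6p4 (n d : ℕ) (A : Matrix (Fin n) (Fin d) ℝ) (p : ℝ) (hp : 2 < p)
    (u : EuclideanSpace ℝ (Fin d)) (v : EuclideanSpace ℝ (Fin n))
    (hu : ‖u‖ = 1) (hv : ‖v‖ = 1)
    (hA : (1 - outerSelf v) * A * outerSelf u = 0) :
    schattenNorm p A ≤
      schattenNorm p
        !![schattenNorm p (outerSelf v * A * outerSelf u),
            schattenNorm p (outerSelf v * A * (1 - outerSelf u));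
          0,
            schattenNorm p ((1 - outerSelf v) * A * (1 - outerSelf u))] := by
  have huu : ⟪u, u⟫_ℝ = 1 := by rw [real_inner_self_eq_norm_sq, hu]; norm_num
  have hvv : ⟪v, v⟫_ℝ = 1 := by rw [real_inner_self_eq_norm_sq, hv]; norm_num
  set T := Matrix.toEuclideanLin A with hT
  set y := LinearMap.adjoint T v with hy
  have hyT : ∀ z, ⟪v, T z⟫_ℝ = ⟪y, z⟫_ℝ := fun z => by rw [hy, LinearMap.adjoint_inner_left]
  set a := ⟪y, u⟫_ℝ with ha
  have hTu : T u = a • v := by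
    have h1 : Matrix.toEuclideanLin ((1 - outerSelf v) * A * outerSelf u) u = 0 := by simp [hA]
    rw [toEuclideanLin_mul_mul_apply, toEuclideanLin_outerSelf_apply,
      toEuclideanLin_one_sub_outerSelf_apply, huu, one_smul, ← hT, hyT] at h1
    exact sub_eq_zero.1 h1
  set w := y - a • u with hw
  have huw : ⟪u, w⟫_ℝ = 0 := by
    rw [hw, inner_sub_right, real_inner_smul_right, huu, real_inner_comm, ← ha]; ring
  have hblock₁ : schattenNorm p (outerSelf v * A * outerSelf u) = |a| := by
    rw [schattenNorm_of_apply_eq_inner_smul hp hv (a • u) fun z => ?_, norm_smul, hu, mul_one,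
      Real.norm_eq_abs]
    rw [toEuclideanLin_mul_mul_apply, toEuclideanLin_outerSelf_apply,
      toEuclideanLin_outerSelf_apply, ← hT, hyT, real_inner_smul_right, ← ha,
      real_inner_smul_left, mul_comm]
  have hblock₂ : schattenNorm p (outerSelf v * A * (1 - outerSelf u)) = ‖w‖ := by
    refine schattenNorm_of_apply_eq_inner_smul hp hv w fun z => ?_
    rw [toEuclideanLin_mul_mul_apply, toEuclideanLin_outerSelf_apply,
      toEuclideanLin_one_sub_outerSelf_apply, ← hT, hyT, hw, inner_sub_left, inner_sub_right,
      real_inner_smul_right, real_inner_smul_left, ← ha, mul_comm]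
  rw [hblock₁, hblock₂]
  set C := (1 - outerSelf v) * A * (1 - outerSelf u) with hC
  have hCT : ∀ z, Matrix.toEuclideanLin C z = T z - ⟪y, z⟫_ℝ • v := fun z => by
    rw [hC, toEuclideanLin_mul_mul_apply, toEuclideanLin_one_sub_outerSelf_apply,
      toEuclideanLin_one_sub_outerSelf_apply, ← hT, hyT, map_sub, map_smul, hTu, inner_sub_right,
      real_inner_smul_right, ← ha]
    module
  -- Pythagoras: ⟨y,z⟩v is the component of Az along v, and the rest equals both Cz and CPz because
  -- Cu = 0.
  have hnorm : ∀ z, ‖T z‖ ^ 2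
      = ⟪y, z⟫_ℝ ^ 2 + ‖Matrix.toEuclideanLin C (z - ⟪u, z⟫_ℝ • u)‖ ^ 2 := fun z => by
    have h1 : Matrix.toEuclideanLin C (z - ⟪u, z⟫_ℝ • u) = T z - ⟪y, z⟫_ℝ • v := by
      rw [map_sub, map_smul, hCT, hCT, hTu, ← ha, sub_self, smul_zero, sub_zero]
    rw [h1, norm_sub_sq_real, real_inner_smul_right, real_inner_comm v, hyT, norm_smul, hv,
      Real.norm_eq_abs, mul_one, sq_abs]
    ring
  -- A unit vector orthogonal to `u` needs d ≥ 2. For d = 1 the blocks other than the first vanish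
  -- and both sides equal |a|.
  obtain rfl | rfl | ⟨m, rfl⟩ : d = 0 ∨ d = 1 ∨ ∃ m, d = m + 2 := by
    rcases d with _ | _ | m <;> simp
  · simp [Subsingleton.elim u 0] at hu
  · have hspan : ∀ z, z = ⟪u, z⟫_ℝ • u := fun z => by
      obtain ⟨c, rfl⟩ := (finrank_eq_one_iff_of_nonzero' u (by rintro rfl; simp at hu)).1
        (finrank_euclideanSpace_fin (𝕜 := ℝ) (n := 1)) z
      rw [real_inner_smul_right, huu, mul_one]
    have hyu : y = a • u := by rw [ha, real_inner_comm]; exact hspan y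
    have hAnorm : schattenNorm p A = |a| := by
      rw [schattenNorm_of_apply_eq_inner_smul hp hv (a • u) fun z => ?_, norm_smul, hu, mul_one,
        Real.norm_eq_abs]
      rw [← hT, hspan z, map_smul, hTu, real_inner_smul_right, real_inner_smul_left, huu,
        smul_smul]
      ring_nf
    have hCnorm : schattenNorm p C = 0 := by
      rw [schattenNorm_of_apply_eq_inner_smul hp hv 0 fun z => ?_, norm_zero]
      rw [hspan z, map_smul, hCT, hTu, ← ha]
      simp
    have htarget : schattenNorm p !![|a|, ‖w‖; 0, schattenNorm p C] = |a| := by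
      rw [schattenNorm_of_apply_eq_inner_smul hp
        (v := EuclideanSpace.single 0 1) (by simp) (EuclideanSpace.single 0 |a|) fun z => ?_]
      · simp
      · rw [hCnorm, hw, hyu, sub_self, norm_zero]
        ext i
        fin_cases i <;>
          simp [Matrix.mulVec, dotProduct, EuclideanSpace.inner_fin_two, mul_comm]
    rw [hAnorm, htarget]
  · obtain ⟨b, hb, hub, hwb⟩ := exists_unit_vector_orthogonal hu huw
    have hyab : y = a • u + ‖w‖ • b := by rw [hwb, hw]; abel
    rcases le_total 0 a with h0 | h0
    · rw [abs_of_nonneg h0]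
      exact schattenNorm_le_of_blocks hp hu hb hub (fun z => by rw [← hyab]; exact hnorm z) rfl
    · rw [abs_of_nonpos h0]
      -- Replacing `u` by `-u` turns the coefficient a into −a = |a| without changing y or the
      -- projection onto uᗮ.
      refine schattenNorm_le_of_blocks (u := -u) hp (by simpa using hu) hb (by simpa using hub)
        (fun z => ?_) rfl
      rw [neg_smul_neg, ← hyab, inner_neg_left, neg_smul_neg]
      exact hnorm z
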